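/- Let $n\ge 1$, let $\mathbb{B}^n=\{z\in\mathbb{C}^n:\|z\|<1\}$ be the open Euclidean unit ball, let $d(z)$ be the Euclidean distance from $z$ to $\partial\mathbb{B}^n$, let $dV_N$ be the Lebesgue volume measure on $\mathbb{B}^n$ normalized to total mass one, and let $d\sigma$ be the surface measure on $\partial\mathbb{B}^n$ normalized to total mass one. Write $\Delta=\sum_{k=1}^n\left(\frac{\partial^2}{\partial x_k^2}+\frac{\partial^2}{\partial y_k^2}\right)$, $z_k=x_k+iy_k$. For $0<p<\infty$ the generalized Hardy space $\mathcal{H}_g^p(\mathbb{B}^n)$ consists of the measurable functions $f:\mathbb{B}^n\to\mathbb{C}$ such that $$M_p(r,f)=\left(\int_{\partial\mathbb{B}^n}|f(r\zeta)|^p\,d\sigma(\zeta)\right)^{1/p}$$ exists (as a finite number) for every $r\in(0,1)$ and $\sup_{0<r<1}M_p(r,f)<\infty$. Let $2\le p<\infty$, let $\tau,\eta:\mathbb{B}^n\to[0,\infty)$ be continuous, and let $f:\mathbb{B}^n\to\mathbb{C}$ be twice continuously differentiable (in the real sense) and satisfy the non-homogeneous Yukawa equation $$\Delta f(z)=\tau(z)f(z)+\eta(z)\,\mathrm{Re}\,f(z),\qquad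 z\in\mathbb{B}^n .$$ Then $$\int_{\mathbb{B}^n} d(z)\,\Delta\big(|f(z)|^p\big)\,dV_N(z)<\infty$$ (that is, the integrand is integrable over $\mathbb{B}^n$) if and only if $f\in\mathcal{H}_g^p(\mathbb{B}^n)$. -/

import Mathlib

open MeasureTheory Metric Set

open scoped Laplacian

noncomputable section

/-- The complex Euclidean space `ℂⁿ` with the Euclidean (Hermitian) norm. Derivatives and the
Laplacian on it are taken over `ℝ`, i.e. it is treated as `ℝ²ⁿ`. -/
abbrev CSpace (n : ℕ) : Type := EuclideanSpace ℂ (Fin n)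

/-- The open unit ball `𝔹ⁿ` of `ℂⁿ`. -/
def unitBall (n : ℕ) : Set (CSpace n) := ball 0 1

/-- `d(z)`: the Euclidean distance from `z` to the boundary of `𝔹ⁿ`. -/
def boundaryDist {n : ℕ} (z : CSpace n) : ℝ := infDist z (frontier (unitBall n))

/-- `dV_N`: Lebesgue measure on `𝔹ⁿ`, normalized to total mass one. -/
def normalizedVolume (n : ℕ) : Measure (CSpace n) :=
  ((volume : Measure (CSpace n)) (unitBall n))⁻¹ •
    (volume : Measure (CSpace n)).restrict (unitBall n)

/-- `dσ`: Lebesgue surface measure on the unit sphere `∂𝔹ⁿ`, normalized to total mass one. -/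
def normalizedSurface (n : ℕ) : Measure (sphere (0 : CSpace n) 1) :=
  ((volume : Measure (CSpace n)).toSphere univ)⁻¹ • (volume : Measure (CSpace n)).toSphere

/-- The integral mean `M_p(r, f) = (∫_{∂𝔹ⁿ} |f(rζ)|^p dσ(ζ))^{1/p}`. -/
def integralMean {n : ℕ} (p r : ℝ) (f : CSpace n → ℂ) : ℝ :=
  (∫ ζ : sphere (0 : CSpace n) 1, ‖f (r • (ζ : CSpace n))‖ ^ p ∂(normalizedSurface n)) ^ (1 / p)

/-- Membership in the generalized Hardy space `H_g^p(𝔹ⁿ)`, `0 < p < ∞`: `f` is Lebesgue measurable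
on `𝔹ⁿ`, the mean `M_p(r, f)` exists for every `0 < r < 1` (the integral that defines it
converges), and `sup_{0 < r < 1} M_p(r, f) < ∞`. Only the values of `f` in `𝔹ⁿ` matter. -/
structure MemGeneralizedHardy {n : ℕ} (p : ℝ) (f : CSpace n → ℂ) : Prop where
  aemeasurable : AEMeasurable f ((volume : Measure (CSpace n)).restrict (unitBall n))
  integrable : ∀ r ∈ Ioo (0 : ℝ) 1,
    Integrable (fun ζ : sphere (0 : CSpace n) 1 => ‖f (r • (ζ : CSpace n))‖ ^ p)
      (normalizedSurface n)
  bddAbove : BddAbove ((fun r : ℝ => integralMean p r f) '' Ioo (0 : ℝ) 1)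

/-- `f` solves the non-homogeneous Yukawa equation `Δf = τ f + η Re f` in `𝔹ⁿ`. -/
def SolvesYukawa {n : ℕ} (τ η : CSpace n → ℝ) (f : CSpace n → ℂ) : Prop :=
  ∀ z ∈ unitBall n, (Δ f) z = (τ z : ℂ) * f z + (η z : ℂ) * ((f z).re : ℂ)

end

/-! Put `u = |f|^p`. Since `p ≥ 2`, `u` is `C²`, and the equation makes it subharmonic: the Hessian
of `|·|^p` is positive semidefinite, and the first-order term of `Δu` is `p|f|^(p-2)` times `⟨f, Δf⟩
= τ|f|² + η(Re f)² ≥ 0` (`laplacian_norm_rpow_nonneg_of_solvesYukawa`).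

For any `C²` function `u` on the ball, Green's formula against a radial weight `G` with `G'(t) =
-t^(-m)` on `(a, R)`, `m = dim - 1`, constant inside radius `a` and zero beyond `R`, gives `∫ G(|x|)
Δu = ∫ (u(Rζ) - u(aζ))` over the unit sphere (`integral_greenWeight_mul_laplacian`). The cutoff at
`a` removes the singularity of the Green function at the origin, so `G` is Lipschitz and one
integration by parts suffices.

For `a = 1/2`, `G` is comparable to `1 - |x| = d(x)`: it is at most `2^m (1 - |x|)` and, away from
radius `R`, at least `(1 - |x|)/4`. As `Δu ≥ 0`, finiteness of `∫ d Δu` is therefore the same as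
boundedness of the spherical integrals of `u`, which is the Hardy condition. -/

/-! ### Integration in polar coordinates. -/

section PolarCoordinates

variable {E : Type*} [NormedAddCommGroup E] [NormedSpace ℝ E] [FiniteDimensional ℝ E]
  [Nontrivial E] [MeasurableSpace E] [BorelSpace E] (μ : Measure E) [μ.IsAddHaarMeasure]

theorem integral_eq_integral_toSphere_integral_Ioi {F : E → ℝ} (hF : Integrable F μ) :
    ∫ x, F x ∂μ = ∫ ζ : sphere (0 : E) 1,
      (∫ r in Ioi (0 : ℝ), r ^ (Module.finrank ℝ E - 1) * F (r • (ζ : E))) ∂μ.toSphere := by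
  set H := homeomorphUnitSphereProd E
  have hmp := μ.measurePreserving_homeomorphUnitSphereProd
  set g : sphere (0 : E) 1 × Ioi (0 : ℝ) → ℝ := fun q => F ((q.2 : ℝ) • (q.1 : E))
  have hg : ∀ x : ({0}ᶜ : Set E), g (H x) = F x := fun x =>
    congrArg (fun y : ({0}ᶜ : Set E) => F y) (H.symm_apply_apply x)
  have hint : Integrable g (μ.toSphere.prod (.volumeIoiPow (Module.finrank ℝ E - 1))) := by
    rw [← hmp.integrable_comp_emb H.measurableEmbedding]
    have : g ∘ H = fun x : ({0}ᶜ : Set E) => F x := funext hg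
    rw [this]
    exact (integrableOn_iff_comap_subtypeVal (measurableSet_singleton _).compl).1 hF.integrableOn
  calc
    ∫ x, F x ∂μ = ∫ x : ({0}ᶜ : Set E), F x ∂(μ.comap (↑)) := by
      rw [integral_subtype_comap (measurableSet_singleton _).compl fun x => F x,
        restrict_compl_singleton]
    _ = ∫ q, g q ∂μ.toSphere.prod (.volumeIoiPow (Module.finrank ℝ E - 1)) := by
      rw [← hmp.integral_comp H.measurableEmbedding g]
      exact integral_congr_ae (.of_forall fun x => (hg x).symm)
    _ = ∫ ζ, ∫ r, g (ζ, r) ∂.volumeIoiPow (Module.finrank ℝ E - 1) ∂μ.toSphere :=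
      integral_prod g hint
    _ = _ := by
      refine integral_congr_ae (.of_forall fun ζ => ?_)
      simp only [Measure.volumeIoiPow, ENNReal.ofReal]
      rw [integral_withDensity_eq_integral_smul,
        integral_subtype_comap measurableSet_Ioi fun a =>
          Real.toNNReal (a ^ (Module.finrank ℝ E - 1)) • F (a • (ζ : E)),
        setIntegral_congr_fun measurableSet_Ioi fun x hx => ?_]
      · rw [NNReal.smul_def, Real.coe_toNNReal _ (pow_nonneg (le_of_lt hx) _), smul_eq_mul]
      · exact (measurable_subtype_coe.pow_const _).real_toNNReal

end PolarCoordinates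

/-! ### The radial Green weight and its bounds. -/

noncomputable section RadialWeight

/-- The function `s ↦ s ^ (-m)` cut off to the interval `(a, R]`. -/
def cutoffInvPow (m : ℕ) (a R : ℝ) : ℝ → ℝ := (Ioc a R).indicator fun s => (s ^ m)⁻¹

/-- The primitive of `-cutoffInvPow m a R` that vanishes on `[R, ∞)`. -/
def greenWeight (m : ℕ) (a R t : ℝ) : ℝ := ∫ s in t..R, cutoffInvPow m a R s

variable {m : ℕ} {a R : ℝ}

theorem measurable_cutoffInvPow : Measurable (cutoffInvPow m a R) :=
  Measurable.indicator (by fun_prop) measurableSet_Ioc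

theorem cutoffInvPow_nonneg (ha : 0 < a) (s : ℝ) : 0 ≤ cutoffInvPow m a R s :=
  indicator_nonneg (fun _ hs => inv_nonneg.2 (pow_nonneg (ha.trans hs.1).le m)) s

theorem cutoffInvPow_le (ha : 0 < a) (s : ℝ) : cutoffInvPow m a R s ≤ (a ^ m)⁻¹ := by
  refine indicator_apply_le' (fun hs => ?_) (fun _ => by positivity)
  have := hs.1.le
  gcongr

theorem norm_cutoffInvPow_le (ha : 0 < a) (s : ℝ) : ‖cutoffInvPow m a R s‖ ≤ (a ^ m)⁻¹ := by
  rw [Real.norm_of_nonneg (cutoffInvPow_nonneg ha s)]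
  exact cutoffInvPow_le ha s

theorem intervalIntegrable_cutoffInvPow (ha : 0 < a) (s t : ℝ) :
    IntervalIntegrable (cutoffInvPow m a R) volume s t := by
  refine (intervalIntegrable_const (c := (a ^ m)⁻¹)).mono_fun
    measurable_cutoffInvPow.aestronglyMeasurable (.of_forall fun x => ?_)
  rw [Real.norm_of_nonneg (by positivity : (0 : ℝ) ≤ (a ^ m)⁻¹)]
  exact norm_cutoffInvPow_le ha x

theorem greenWeight_sub (ha : 0 < a) (s t : ℝ) :
    greenWeight m a R s - greenWeight m a R t = ∫ x in s..t, cutoffInvPow m a R x := by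
  unfold greenWeight
  rw [← intervalIntegral.integral_add_adjacent_intervals
    (intervalIntegrable_cutoffInvPow ha s t) (intervalIntegrable_cutoffInvPow ha t R)]
  ring

theorem lipschitzWith_greenWeight (ha : 0 < a) :
    LipschitzWith (Real.toNNReal (a ^ m)⁻¹) (greenWeight m a R) := by
  refine LipschitzWith.of_dist_le_mul fun s t => ?_
  rw [Real.dist_eq, greenWeight_sub ha, Real.coe_toNNReal _ (by positivity), dist_comm,
    Real.dist_eq]
  exact intervalIntegral.norm_integral_le_of_norm_le_const fun x _ => norm_cutoffInvPow_le ha x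

theorem greenWeight_of_ge {t : ℝ} (ht : R ≤ t) : greenWeight m a R t = 0 := by
  unfold greenWeight
  rw [intervalIntegral.integral_symm, intervalIntegral.integral_of_le ht, neg_eq_zero]
  refine setIntegral_eq_zero_of_forall_eq_zero fun x hx => ?_
  exact indicator_of_notMem (fun h => absurd hx.1 (not_lt.2 h.2)) _

theorem greenWeight_of_le (ha : 0 < a) {t : ℝ} (ht : t ≤ a) :
    greenWeight m a R t = greenWeight m a R a := by
  rw [← sub_eq_zero, greenWeight_sub ha, intervalIntegral.integral_of_le ht]
  refine setIntegral_eq_zero_of_forall_eq_zero fun x hx => ?_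
  exact indicator_of_notMem (fun h => absurd h.1 (not_lt.2 hx.2)) _

theorem greenWeight_nonneg (ha : 0 < a) (t : ℝ) : 0 ≤ greenWeight m a R t := by
  rcases le_total t R with h | h
  · exact intervalIntegral.integral_nonneg h fun s _ => cutoffInvPow_nonneg ha s
  · exact (greenWeight_of_ge h).ge

theorem greenWeight_le (ha : 0 < a) {b t : ℝ} (hRb : R ≤ b) (htb : t ≤ b) :
    greenWeight m a R t ≤ (a ^ m)⁻¹ * (b - t) := by
  have := (lipschitzWith_greenWeight (m := m) (R := R) ha).dist_le_mul t b
  rw [greenWeight_of_ge hRb, Real.coe_toNNReal _ (by positivity), dist_zero_right, Real.dist_eq,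
    abs_sub_comm, abs_of_nonneg (sub_nonneg.2 htb)] at this
  exact (Real.le_norm_self _).trans this

/-- Because `R ≤ 1`, the integrand `s^(-m)` is at least `1` on `(a, R]`. -/
theorem sub_le_greenWeight (ha : 0 < a) (hR : R ≤ 1) {t : ℝ} (hat : a ≤ t) (htR : t ≤ R) :
    R - t ≤ greenWeight m a R t := by
  have h1 : (∫ _ in t..R, (1 : ℝ)) ≤ ∫ s in t..R, cutoffInvPow m a R s := by
    refine intervalIntegral.integral_mono_on_of_le_Ioo htR (by simp)
      (intervalIntegrable_cutoffInvPow ha _ _) fun s hs => ?_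
    have h0 : 0 < s := ha.trans_le (hat.trans hs.1.le)
    rw [cutoffInvPow, indicator_of_mem (mem_Ioc.2 ⟨hat.trans_lt hs.1, hs.2.le⟩)]
    exact (one_le_inv₀ (pow_pos h0 m)).2 (pow_le_one₀ h0.le (hs.2.le.trans hR))
  simpa [greenWeight] using h1

/-- The cutoff jumps only at `a` and `R`; elsewhere it is continuous and the fundamental theorem of
calculus applies. -/
theorem hasDerivAt_greenWeight (ha : 0 < a) {t : ℝ} (hta : t ≠ a) (htR : t ≠ R) :
    HasDerivAt (greenWeight m a R) (-cutoffInvPow m a R t) t := by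
  refine intervalIntegral.integral_hasDerivAt_left (intervalIntegrable_cutoffInvPow ha _ _)
    measurable_cutoffInvPow.stronglyMeasurable.stronglyMeasurableAtFilter ?_
  rcases lt_or_gt_of_ne hta with h | h
  · have : cutoffInvPow m a R =ᶠ[nhds t] fun _ => 0 := by
      filter_upwards [Iio_mem_nhds h] with x hx
      exact indicator_of_notMem (fun h => absurd h.1 (not_lt.2 (le_of_lt hx))) _
    exact continuousAt_const.congr this.symm
  · rcases lt_or_gt_of_ne htR with h' | h'
    · have : cutoffInvPow m a R =ᶠ[nhds t] fun s => (s ^ m)⁻¹ := by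
        filter_upwards [Ioo_mem_nhds h h'] with x hx
        exact indicator_of_mem (mem_Ioc.2 ⟨hx.1, hx.2.le⟩) _
      refine ContinuousAt.congr ?_ this.symm
      exact (continuousAt_id.pow m).inv₀ (pow_ne_zero _ (ha.trans h).ne')
    · have : cutoffInvPow m a R =ᶠ[nhds t] fun _ => 0 := by
        filter_upwards [Ioi_mem_nhds h'] with x hx
        exact indicator_of_notMem (fun h => absurd hx (not_lt.2 h.2)) _
      exact continuousAt_const.congr this.symm

end RadialWeight

/-! ### Regularity and convexity of powers of the norm. -/

section NormPow

variable {F : Type*} [NormedAddCommGroup F] [InnerProductSpace ℝ F]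

/-- At the origin the map is `o(‖y‖)`, and the second term vanishes through `innerSL ℝ 0 = 0`,
whatever value `0 ^ (q - 2)` takes. -/
theorem hasFDerivAt_norm_rpow_smul_id {q : ℝ} (hq : 0 < q) (x : F) :
    HasFDerivAt (fun y : F => ‖y‖ ^ q • y)
      (‖x‖ ^ q • ContinuousLinearMap.id ℝ F +
        (q * ‖x‖ ^ (q - 2)) • (innerSL ℝ x).smulRight x) x := by
  by_cases hx : x = 0
  · subst hx
    simp only [norm_zero, Real.zero_rpow hq.ne', zero_smul, map_zero, zero_add]
    refine .of_isLittleO ?_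
    have h0 : Filter.Tendsto (fun y : F => ‖y‖ ^ q) (nhds 0) (nhds 0) := by
      have : Continuous fun y : F => ‖y‖ ^ q := continuous_norm.rpow_const fun _ => .inr hq.le
      simpa [hq.ne'] using this.tendsto 0
    have h1 : (fun y : F => ‖y‖ ^ q • y) =o[nhds 0] fun y : F => (1 : ℝ) • y :=
      ((Asymptotics.isLittleO_one_iff ℝ).2 h0).smul_isBigO (Asymptotics.isBigO_refl _ _)
    simpa [Real.zero_rpow hq.ne'] using h1
  · have h1 : HasFDerivAt (fun y : F => ‖y‖ ^ q) ((q * ‖x‖ ^ (q - 2)) • innerSL ℝ x) x := by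
      apply HasStrictFDerivAt.hasFDerivAt
      convert! (hasStrictFDerivAt_norm_sq x).rpow_const (p := q / 2) (by simp [hx]) using 0
      simp_rw [← Real.rpow_natCast_mul (norm_nonneg _), ← Nat.cast_smul_eq_nsmul ℝ, smul_smul]
      ring_nf
    refine (h1.smul (hasFDerivAt_id x)).congr_fderiv ?_
    ext v
    simp [smul_smul]

theorem contDiff_one_norm_rpow_smul_id {q : ℝ} (hq : 0 ≤ q) :
    ContDiff ℝ 1 (fun y : F => ‖y‖ ^ q • y) := by
  rcases hq.eq_or_lt with rfl | hq
  · simp only [Real.rpow_zero, one_smul]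
    exact contDiff_id
  rw [contDiff_one_iff_fderiv]
  refine ⟨fun x => (hasFDerivAt_norm_rpow_smul_id hq x).differentiableAt, ?_⟩
  have hfd : (fderiv ℝ fun y : F => ‖y‖ ^ q • y) = fun x => ‖x‖ ^ q • ContinuousLinearMap.id ℝ F +
        (q * ‖x‖ ^ (q - 2)) • (innerSL ℝ x).smulRight x :=
    funext fun x => (hasFDerivAt_norm_rpow_smul_id hq x).fderiv
  rw [hfd]
  have hc : Continuous fun y : F => ‖y‖ ^ q := continuous_norm.rpow_const fun _ => .inr hq.le
  refine (hc.smul continuous_const).add ?_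
  rw [continuous_iff_continuousAt]
  intro x
  by_cases hx : x = 0
  · subst hx
    -- The negative power is absorbed by the two factors `y`, so this term tends to `0` at the
    -- origin even when `q < 2`.
    have hle : ∀ y : F, ‖(q * ‖y‖ ^ (q - 2)) • (innerSL ℝ y).smulRight y‖ ≤ q * ‖y‖ ^ q := by
      intro y
      rw [norm_smul, ContinuousLinearMap.norm_smulRight_apply, innerSL_apply_norm,
        Real.norm_of_nonneg (by positivity)]
      rcases (norm_nonneg y).eq_or_lt with h | h
      · rw [← h]; simp [hq.ne']
      · rw [Real.rpow_sub h, Real.rpow_two]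
        apply le_of_eq
        field_simp
    have hz : (q * ‖(0 : F)‖ ^ (q - 2)) • (innerSL ℝ (0 : F)).smulRight (0 : F) = 0 := by
      ext v
      simp
    have h0 : Filter.Tendsto (fun y : F => q * ‖y‖ ^ q) (nhds 0) (nhds 0) := by
      have h : Continuous fun y : F => q * ‖y‖ ^ q := continuous_const.mul hc
      simpa [hq.ne'] using h.tendsto 0
    rw [ContinuousAt, hz]
    exact squeeze_zero_norm hle h0
  · have h1 : ContinuousAt (fun y : F => q * ‖y‖ ^ (q - 2)) x :=
      continuousAt_const.mul (continuous_norm.continuousAt.rpow_const (.inl (norm_ne_zero_iff.2 hx)))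
    exact h1.smul ((ContinuousLinearMap.smulRightL ℝ F F).continuous₂.comp
      ((innerSL ℝ).continuous.prodMk continuous_id)).continuousAt

theorem fderiv_norm_rpow_eq {p : ℝ} (hp : 1 < p) :
    fderiv ℝ (fun x : F => ‖x‖ ^ p) = fun x => innerSL ℝ (p • (‖x‖ ^ (p - 2) • x)) := by
  ext x v
  rw [fderiv_norm_rpow x hp]
  simp [mul_assoc]

theorem contDiff_two_norm_rpow {p : ℝ} (hp : 2 ≤ p) : ContDiff ℝ 2 (fun x : F => ‖x‖ ^ p) := by
  have h2 : (2 : WithTop ℕ∞) = 1 + 1 := by norm_num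
  rw [h2, contDiff_succ_iff_fderiv]
  refine ⟨differentiable_norm_rpow (by linarith), by simp, ?_⟩
  rw [fderiv_norm_rpow_eq (by linarith)]
  exact (innerSL ℝ).contDiff.comp
    (contDiff_const.smul (contDiff_one_norm_rpow_smul_id (by linarith)))

/-- Off the origin the Hessian form is `p(‖x‖^(p-2) ‖v‖² + (p-2) ‖x‖^(p-4) ⟨x,v⟩²)`. The case `p =
2` is separate because the derivative formula needs a positive exponent. -/
theorem fderiv_fderiv_norm_rpow_nonneg {p : ℝ} (hp : 2 ≤ p) (x v : F) :
    0 ≤ fderiv ℝ (fderiv ℝ (fun x : F => ‖x‖ ^ p)) x v v := by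
  rw [fderiv_norm_rpow_eq (by linarith)]
  have hd : DifferentiableAt ℝ (fun y : F => p • (‖y‖ ^ (p - 2) • y)) x :=
    ((contDiff_one_norm_rpow_smul_id (by linarith)).differentiable one_ne_zero x).const_smul p
  have h1 : fderiv ℝ (fun x : F => innerSL ℝ (p • (‖x‖ ^ (p - 2) • x))) x v v =
      inner ℝ (p • fderiv ℝ (fun y : F => ‖y‖ ^ (p - 2) • y) x v) v := by
    have := ((innerSL ℝ (E := F)).hasFDerivAt.comp x hd.hasFDerivAt).fderiv
    simp only [Function.comp_def] at this
    rw [this, fderiv_fun_const_smul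
      ((contDiff_one_norm_rpow_smul_id (by linarith)).differentiable one_ne_zero x)]
    rfl
  rw [h1, real_inner_smul_left]
  refine mul_nonneg (by linarith) ?_
  rcases hp.eq_or_lt with rfl | hp'
  · simp only [sub_self, Real.rpow_zero, one_smul, fderiv_fun_id]
    exact real_inner_self_nonneg
  · rw [(hasFDerivAt_norm_rpow_smul_id (by linarith : 0 < p - 2) x).fderiv]
    simp only [add_apply, smul_apply,
      ContinuousLinearMap.id_apply, ContinuousLinearMap.smulRight_apply, innerSL_apply_apply,
      inner_add_left, real_inner_smul_left]
    have := mul_self_nonneg (inner ℝ x v)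
    have h3 : 0 ≤ p - 2 := by linarith
    have := real_inner_self_nonneg (x := v)
    positivity

end NormPow

/-! ### Chain rule for the Laplacian, and subharmonicity of `|f|^p`. -/

section Laplacian

variable {E F G : Type*} [NormedAddCommGroup E] [InnerProductSpace ℝ E]
  [NormedAddCommGroup F] [NormedSpace ℝ F] [NormedAddCommGroup G] [NormedSpace ℝ G]

theorem laplacian_apply_eq_sum_fderiv [FiniteDimensional ℝ E] (f : E → F) (x : E) :
    (Δ f) x = ∑ i, fderiv ℝ (fderiv ℝ f) x (stdOrthonormalBasis ℝ E i)
      (stdOrthonormalBasis ℝ E i) := by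
  rw [InnerProductSpace.laplacian_eq_iteratedFDeriv_stdOrthonormalBasis]
  simp [iteratedFDeriv_two_apply]

theorem fderiv_fderiv_comp_apply {g : F → G} {f : E → F} {x : E} (hg : ContDiff ℝ 2 g)
    (hf : ContDiffAt ℝ 2 f x) (v w : E) :
    fderiv ℝ (fderiv ℝ (fun y => g (f y))) x v w =
      fderiv ℝ (fderiv ℝ g) (f x) (fderiv ℝ f x v) (fderiv ℝ f x w) +
        fderiv ℝ g (f x) (fderiv ℝ (fderiv ℝ f) x v w) := by
  have h1 : fderiv ℝ (fun y => g (f y)) =ᶠ[nhds x]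
      fun y => (fderiv ℝ g (f y)).comp (fderiv ℝ f y) := by
    filter_upwards [hf.eventually (by simp)] with y hy
    exact fderiv_comp y (hg.differentiable two_ne_zero _) (hy.differentiableAt two_ne_zero)
  rw [h1.fderiv_eq]
  have h2 : (1 : WithTop ℕ∞) + 1 ≤ 2 := by norm_num
  have hdg : DifferentiableAt ℝ (fderiv ℝ g) (f x) :=
    (hg.fderiv_right h2).differentiable one_ne_zero _
  have hdf : DifferentiableAt ℝ (fderiv ℝ f) x :=
    (hf.fderiv_right h2).differentiableAt one_ne_zero
  have hc := (hdg.hasFDerivAt.comp x (hf.differentiableAt two_ne_zero).hasFDerivAt).clm_comp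
    hdf.hasFDerivAt
  rw [show (fun y => (fderiv ℝ g (f y)).comp (fderiv ℝ f y)) =
    fun y => ((fderiv ℝ g ∘ f) y).comp (fderiv ℝ f y) from rfl, hc.fderiv]
  simp [add_comm]

theorem laplacian_comp_apply [FiniteDimensional ℝ E] {g : F → G} {f : E → F} {x : E}
    (hg : ContDiff ℝ 2 g) (hf : ContDiffAt ℝ 2 f x) :
    (Δ fun y => g (f y)) x =
      (∑ i, fderiv ℝ (fderiv ℝ g) (f x) (fderiv ℝ f x (stdOrthonormalBasis ℝ E i))
        (fderiv ℝ f x (stdOrthonormalBasis ℝ E i))) + fderiv ℝ g (f x) ((Δ f) x) := by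
  rw [laplacian_apply_eq_sum_fderiv, laplacian_apply_eq_sum_fderiv, map_sum,
    ← Finset.sum_add_distrib]
  exact Finset.sum_congr rfl fun i _ => fderiv_fderiv_comp_apply hg hf _ _

theorem continuousOn_laplacian [FiniteDimensional ℝ E] {f : E → F} {s : Set E} (hs : IsOpen s)
    (hf : ContDiffOn ℝ 2 f s) : ContinuousOn (Δ f) s := by
  have h2 : (1 : WithTop ℕ∞) + 1 ≤ 2 := by norm_num
  have h1 : ContinuousOn (fderiv ℝ (fderiv ℝ f)) s :=
    (hf.fderiv_of_isOpen hs h2).continuousOn_fderiv_of_isOpen hs le_rfl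
  have : Δ f = fun x => ∑ i, fderiv ℝ (fderiv ℝ f) x (stdOrthonormalBasis ℝ E i)
      (stdOrthonormalBasis ℝ E i) := funext fun x => laplacian_apply_eq_sum_fderiv f x
  rw [this]
  fun_prop

end Laplacian

theorem laplacian_norm_rpow_nonneg_of_solvesYukawa {n : ℕ} {p : ℝ} (hp : 2 ≤ p)
    {τ η : CSpace n → ℝ} {f : CSpace n → ℂ} (hf : ContDiffOn ℝ 2 f (unitBall n))
    (hfeq : SolvesYukawa τ η f) {z : CSpace n} (hz : z ∈ unitBall n) (hτ : 0 ≤ τ z)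
    (hη : 0 ≤ η z) : 0 ≤ (Δ fun w : CSpace n => ‖f w‖ ^ p) z := by
  have hfz : ContDiffAt ℝ 2 f z := hf.contDiffAt (isOpen_ball.mem_nhds hz)
  rw [laplacian_comp_apply (contDiff_two_norm_rpow hp) hfz]
  refine add_nonneg (Finset.sum_nonneg fun i _ => fderiv_fderiv_norm_rpow_nonneg hp _ _) ?_
  rw [fderiv_norm_rpow _ (by linarith : 1 < p), hfeq z hz]
  simp only [smul_apply, innerSL_apply_apply, smul_eq_mul]
  refine mul_nonneg (mul_nonneg (by linarith) (by positivity)) ?_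
  simp only [Complex.inner, Complex.add_re, Complex.mul_re, Complex.mul_im,
    Complex.add_im, Complex.ofReal_re, Complex.ofReal_im, Complex.conj_re, Complex.conj_im]
  -- The pairing equals `τ|f|² + η(Re f)²`.
  nlinarith [mul_nonneg hτ (sq_nonneg (f z).re), mul_nonneg hτ (sq_nonneg (f z).im),
    mul_nonneg hη (sq_nonneg (f z).re)]

/-! ### Green's formula with the radial weight. -/

section Green

theorem lipschitzWith_greenWeight_norm {E : Type*} [NormedAddCommGroup E] {m : ℕ} {a R : ℝ}
    (ha : 0 < a) :
    LipschitzWith (Real.toNNReal (a ^ m)⁻¹) fun x : E => greenWeight m a R ‖x‖ := by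
  have h := (lipschitzWith_greenWeight (m := m) (R := R) ha).comp (lipschitzWith_one_norm (E := E))
  rw [mul_one] at h
  exact h

variable {E : Type*} [NormedAddCommGroup E] [InnerProductSpace ℝ E]

theorem lineDeriv_greenWeight_norm {m : ℕ} {a R : ℝ} (ha : 0 < a) {x : E} (hx0 : ‖x‖ ≠ 0)
    (hxa : ‖x‖ ≠ a) (hxR : ‖x‖ ≠ R) (v : E) :
    lineDeriv ℝ (fun x : E => greenWeight m a R ‖x‖) x (-v) =
      cutoffInvPow m a R ‖x‖ * (‖x‖⁻¹ * inner ℝ v x) := by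
  have h1 : HasFDerivAt (fun y : E => ‖y‖) (‖x‖⁻¹ • innerSL ℝ x) x := by
    have h := (hasStrictFDerivAt_norm_sq x).hasFDerivAt.sqrt (pow_ne_zero 2 hx0)
    simp only [Real.sqrt_sq (norm_nonneg _)] at h
    refine h.congr_fderiv ?_
    ext w
    simp
    field_simp
  have h2 := (hasDerivAt_greenWeight (m := m) ha hxa hxR).comp_hasFDerivAt x h1
  have h3 := h2.hasLineDerivAt (-v)
  rw [show (fun x : E => greenWeight m a R ‖x‖) = greenWeight m a R ∘ fun y : E => ‖y‖ from rfl,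
    h3.lineDeriv]
  simp [real_inner_comm]

variable [FiniteDimensional ℝ E]

theorem exists_contDiff_hasCompactSupport_eqOn_ball {u : E → ℝ}
    (hu : ContDiffOn ℝ 2 u (ball 0 1)) {R : ℝ} (hR0 : 0 < R) (hR : R < 1) :
    ∃ v : E → ℝ, ContDiff ℝ 2 v ∧ HasCompactSupport v ∧
      ∃ R' > R, EqOn v u (ball 0 R') := by
  -- The two radii cut `[R, 1]` into thirds.
  set χ : ContDiffBump (0 : E) := ⟨(2 * R + 1) / 3, (R + 2) / 3, by linarith, by linarith⟩
  refine ⟨fun x => χ x * u x, ?_, χ.hasCompactSupport.mul_right, (2 * R + 1) / 3, by linarith,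
    fun x hx => ?_⟩
  · rw [contDiff_iff_contDiffAt]
    intro x
    by_cases hx : x ∈ ball (0 : E) 1
    · exact χ.contDiffAt.mul (hu.contDiffAt (isOpen_ball.mem_nhds hx))
    · have hx' : x ∈ (tsupport χ)ᶜ := by
        rw [χ.tsupport_eq, mem_compl_iff, mem_closedBall_zero_iff, not_le]
        rw [mem_ball_zero_iff, not_lt] at hx
        change (R + 2) / 3 < ‖x‖
        linarith
      have h0 : (fun x => χ x * u x) =ᶠ[nhds x] fun _ => 0 := by
        filter_upwards [(isClosed_tsupport _).isOpen_compl.mem_nhds hx'] with y hy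
        rw [image_eq_zero_of_notMem_tsupport hy, zero_mul]
      exact contDiffAt_const.congr_of_eventuallyEq h0
  · simp only [χ.one_of_mem_closedBall (ball_subset_closedBall hx), one_mul]

variable [Nontrivial E] [MeasurableSpace E] [BorelSpace E]
  (μ : Measure E) [μ.IsAddHaarMeasure]

/-- One integration by parts turns the left side into the integral of `|x|^(-m) ∂ᵣu` over the shell
`a < |x| ≤ R`. The polar Jacobian `r^m` cancels the weight, leaving `∫ ∂ᵣu dr` on each ray. -/
theorem integral_greenWeight_mul_laplacian_of_hasCompactSupport {u : E → ℝ}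
    (hu : ContDiff ℝ 2 u) (huc : HasCompactSupport u) {a R : ℝ} (ha : 0 < a) (haR : a ≤ R) :
    ∫ x, greenWeight (Module.finrank ℝ E - 1) a R ‖x‖ * (Δ u) x ∂μ =
      ∫ ζ : sphere (0 : E) 1, (u (R • (ζ : E)) - u (a • (ζ : E))) ∂μ.toSphere := by
  set m := Module.finrank ℝ E - 1
  set φ : E → ℝ := fun x => greenWeight m a R ‖x‖
  have hφ : LipschitzWith (Real.toNNReal (a ^ m)⁻¹) φ := lipschitzWith_greenWeight_norm ha
  have hφc : HasCompactSupport φ := by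
    refine HasCompactSupport.of_support_subset_isCompact (isCompact_closedBall (0 : E) R) ?_
    intro x hx
    rw [mem_closedBall_zero_iff]
    by_contra h
    exact hx (greenWeight_of_ge (not_le.1 h).le)
  set b := stdOrthonormalBasis ℝ E
  have h2 : (1 : WithTop ℕ∞) + 1 ≤ 2 := by norm_num
  have hdu : ContDiff ℝ 1 (fderiv ℝ u) := hu.fderiv_right h2
  have hddu : Continuous (fderiv ℝ (fderiv ℝ u)) := hdu.continuous_fderiv one_ne_zero
  have hw : ∀ i, ContDiff ℝ 1 fun x => fderiv ℝ u x (b i) := fun i => hdu.clm_apply contDiff_const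
  have hwc : ∀ i, HasCompactSupport fun x => fderiv ℝ u x (b i) := fun i => huc.fderiv_apply ℝ (b i)
  have hline : ∀ i x, lineDeriv ℝ (fun x => fderiv ℝ u x (b i)) x (b i) =
      fderiv ℝ (fderiv ℝ u) x (b i) (b i) := by
    intro i x
    rw [((hw i).differentiable one_ne_zero x).lineDeriv_eq_fderiv,
      fderiv_clm_apply (hdu.differentiable one_ne_zero x) (differentiableAt_const _)]
    simp
  have hparts : ∀ i, ∫ x, φ x * fderiv ℝ (fderiv ℝ u) x (b i) (b i) ∂μ =
      ∫ x, lineDeriv ℝ φ x (-b i) * fderiv ℝ u x (b i) ∂μ := by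
    intro i
    obtain ⟨C, hC⟩ := (hw i).lipschitzWith_of_hasCompactSupport (hwc i) one_ne_zero
    rw [← hC.integral_lineDeriv_mul_eq hφ hφc (b i)]
    exact integral_congr_ae (.of_forall fun x => by simp only [hline, mul_comm])
  have hint1 : ∀ i, Integrable (fun x => φ x * fderiv ℝ (fderiv ℝ u) x (b i) (b i)) μ := by
    intro i
    refine Continuous.integrable_of_hasCompactSupport ?_ hφc.mul_right
    have := hφ.continuous
    fun_prop
  have hint2 : ∀ i, Integrable (fun x => lineDeriv ℝ φ x (-b i) * fderiv ℝ u x (b i)) μ :=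
    fun i => ((hw i).continuous.integrable_of_hasCompactSupport (hwc i)).smul_of_top_right
      (hφ.memLp_lineDeriv (-b i))
  set F : E → ℝ := fun x => cutoffInvPow m a R ‖x‖ * (‖x‖⁻¹ * fderiv ℝ u x x)
  have hsum : (fun x => ∑ i, lineDeriv ℝ φ x (-b i) * fderiv ℝ u x (b i)) =ᵐ[μ] F := by
    -- Spheres are null, so the origin and the two radii where the weight has a kink may be
    -- discarded.
    have hs : ∀ r : ℝ, ∀ᵐ x : E ∂μ, ‖x‖ ≠ r := fun r => by
      have := Measure.addHaar_sphere μ (0 : E) r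
      rw [← compl_mem_ae_iff] at this
      filter_upwards [this] with x hx h
      exact hx (mem_sphere_zero_iff_norm.2 h)
    filter_upwards [hs 0, hs a, hs R] with x h0 h1 h2
    simp only [F, φ, lineDeriv_greenWeight_norm ha h0 h1 h2]
    have hx : fderiv ℝ u x x = ∑ i, fderiv ℝ u x (inner ℝ (b i) x • b i) := by
      rw [← map_sum, b.sum_repr' x]
    rw [hx, Finset.mul_sum, Finset.mul_sum]
    refine Finset.sum_congr rfl fun i _ => ?_
    rw [map_smul, smul_eq_mul]
    ring
  have hF : Integrable F μ := (integrable_finsetSum _ fun i _ => hint2 i).congr hsum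
  calc
    ∫ x, φ x * (Δ u) x ∂μ = ∫ x, ∑ i, φ x * fderiv ℝ (fderiv ℝ u) x (b i) (b i) ∂μ := by
      simp only [laplacian_apply_eq_sum_fderiv, Finset.mul_sum, b]
    _ = ∫ x, F x ∂μ := by
      rw [integral_finsetSum _ fun i _ => hint1 i, ← integral_congr_ae hsum,
        integral_finsetSum _ fun i _ => hint2 i]
      exact Finset.sum_congr rfl fun i _ => hparts i
    _ = _ := by
      rw [integral_eq_integral_toSphere_integral_Ioi μ hF]
      refine integral_congr_ae (.of_forall fun ζ => ?_)
      have hζ : ‖(ζ : E)‖ = 1 := mem_sphere_zero_iff_norm.1 ζ.2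
      have hd : ∀ r : ℝ, HasDerivAt (fun r : ℝ => u (r • (ζ : E)))
          (fderiv ℝ u (r • (ζ : E)) ζ) r := fun r => by
        have h1 : HasDerivAt (fun r : ℝ => r • (ζ : E)) ((1 : ℝ) • (ζ : E)) r :=
          (hasDerivAt_id r).smul_const _
        rw [one_smul] at h1
        exact (hu.differentiable two_ne_zero _).hasFDerivAt.comp_hasDerivAt r h1
      have hcont : Continuous fun r : ℝ => fderiv ℝ u (r • (ζ : E)) ζ := by
        have := hdu.continuous
        fun_prop
      calc
        ∫ r in Ioi (0 : ℝ), r ^ m * F (r • (ζ : E)) = ∫ r in Ioi (0 : ℝ),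
            (Ioc a R).indicator (fun r => fderiv ℝ u (r • (ζ : E)) ζ) r := by
          refine setIntegral_congr_fun measurableSet_Ioi fun r hr => ?_
          have hr : 0 < r := hr
          simp only [F, norm_smul, hζ, mul_one, Real.norm_of_nonneg hr.le, map_smul, smul_eq_mul,
            cutoffInvPow, inv_mul_cancel_left₀ hr.ne']
          by_cases h : r ∈ Ioc a R
          · rw [indicator_of_mem h, indicator_of_mem h, mul_inv_cancel_left₀ (pow_ne_zero _ hr.ne')]
          · simp [indicator_of_notMem h]
        _ = ∫ r in a..R, fderiv ℝ u (r • (ζ : E)) ζ := by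
          rw [setIntegral_indicator measurableSet_Ioc, intervalIntegral.integral_of_le haR,
            inter_eq_self_of_subset_right (Ioc_subset_Ioi_self.trans (Ioi_subset_Ioi ha.le))]
        _ = u (R • (ζ : E)) - u (a • (ζ : E)) :=
          intervalIntegral.integral_eq_sub_of_hasDerivAt (fun r _ => hd r)
            (hcont.intervalIntegrable _ _)

theorem integral_greenWeight_mul_laplacian {u : E → ℝ} (hu : ContDiffOn ℝ 2 u (ball 0 1))
    {a R : ℝ} (ha : 0 < a) (haR : a ≤ R) (hR : R < 1) :
    ∫ x, greenWeight (Module.finrank ℝ E - 1) a R ‖x‖ * (Δ u) x ∂μ =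
      ∫ ζ : sphere (0 : E) 1, (u (R • (ζ : E)) - u (a • (ζ : E))) ∂μ.toSphere := by
  obtain ⟨v, hv, hvc, R', hR', hvu⟩ :=
    exists_contDiff_hasCompactSupport_eqOn_ball hu (ha.trans_le haR) hR
  have hmain := integral_greenWeight_mul_laplacian_of_hasCompactSupport μ hv hvc ha haR
  have h1 : ∀ x : E, greenWeight (Module.finrank ℝ E - 1) a R ‖x‖ * (Δ u) x =
      greenWeight (Module.finrank ℝ E - 1) a R ‖x‖ * (Δ v) x := by
    intro x
    rcases le_or_gt R ‖x‖ with h | h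
    -- The weight vanishes here, so `Δ u` may be arbitrary outside the ball.
    · simp [greenWeight_of_ge h]
    · have hx : x ∈ ball (0 : E) R' := mem_ball_zero_iff.2 (h.trans hR')
      rw [(InnerProductSpace.laplacian_congr_nhds
        (hvu.eventuallyEq_of_mem (isOpen_ball.mem_nhds hx))).self_of_nhds]
  have h2 : ∀ r, 0 < r → r ≤ R → ∀ ζ : sphere (0 : E) 1, v (r • (ζ : E)) = u (r • (ζ : E)) := by
    intro r h0 hr ζ
    refine hvu (mem_ball_zero_iff.2 ?_)
    rw [norm_smul, mem_sphere_zero_iff_norm.1 ζ.2, mul_one, Real.norm_of_nonneg h0.le]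
    exact hr.trans_lt hR'
  simp only [h1, hmain, h2 R (ha.trans_le haR) le_rfl, h2 a ha haR]

end Green

/-! ### Weighted integrability of the Laplacian versus bounded spherical integrals. -/

section Subharmonic

variable {E : Type*} [NormedAddCommGroup E] [InnerProductSpace ℝ E] [FiniteDimensional ℝ E]
  [MeasurableSpace E] [BorelSpace E] (μ : Measure E) [μ.IsAddHaarMeasure]

theorem integrable_comp_smul_toSphere {u : E → ℝ} (hu : ContinuousOn u (ball 0 1)) {r : ℝ}
    (hr : r ∈ Ioo (0 : ℝ) 1) :
    Integrable (fun ζ : sphere (0 : E) 1 => u (r • (ζ : E))) μ.toSphere := by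
  have hc : Continuous fun ζ : sphere (0 : E) 1 => u (r • (ζ : E)) := by
    refine hu.comp_continuous (by fun_prop) fun ζ => ?_
    rw [mem_ball_zero_iff, norm_smul, mem_sphere_zero_iff_norm.1 ζ.2, mul_one,
      Real.norm_of_nonneg hr.1.le]
    exact hr.2
  exact hc.integrable_of_hasCompactSupport (HasCompactSupport.of_compactSpace _)

variable [Nontrivial E]

theorem integral_toSphere_sub_eq_setIntegral {u : E → ℝ} (hu : ContDiffOn ℝ 2 u (ball 0 1))
    {a R : ℝ} (ha : 0 < a) (haR : a ≤ R) (hR : R < 1) :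
    ∫ ζ : sphere (0 : E) 1, u (R • (ζ : E)) ∂μ.toSphere -
        ∫ ζ : sphere (0 : E) 1, u (a • (ζ : E)) ∂μ.toSphere =
      ∫ x in ball (0 : E) 1, greenWeight (Module.finrank ℝ E - 1) a R ‖x‖ * (Δ u) x ∂μ := by
  rw [setIntegral_eq_integral_of_forall_compl_eq_zero,
    integral_greenWeight_mul_laplacian μ hu ha haR hR,
    integral_sub (integrable_comp_smul_toSphere μ hu.continuousOn ⟨ha.trans_le haR, hR⟩)
      (integrable_comp_smul_toSphere μ hu.continuousOn ⟨ha, haR.trans_lt hR⟩)]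
  intro x hx
  rw [mem_ball_zero_iff, not_lt] at hx
  rw [greenWeight_of_ge (hR.le.trans hx), zero_mul]

theorem bddAbove_integral_toSphere_of_integrableOn_laplacian {u : E → ℝ}
    (hu : ContDiffOn ℝ 2 u (ball 0 1)) (hΔ : ∀ x ∈ ball (0 : E) 1, 0 ≤ (Δ u) x)
    (hint : IntegrableOn (fun x => (1 - ‖x‖) * (Δ u) x) (ball 0 1) μ) :
    BddAbove ((fun r : ℝ => ∫ ζ : sphere (0 : E) 1, u (r • (ζ : E)) ∂μ.toSphere) ''
      Ioo (0 : ℝ) 1) := by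
  set m := Module.finrank ℝ E - 1
  set K : ℝ := ((1 / 2 : ℝ) ^ m)⁻¹ * ∫ x in ball (0 : E) 1, (1 - ‖x‖) * (Δ u) x ∂μ
  have hnn : ∀ a R : ℝ, 0 < a → ∀ x ∈ ball (0 : E) 1, 0 ≤ greenWeight m a R ‖x‖ * (Δ u) x :=
    fun a R ha x hx => mul_nonneg (greenWeight_nonneg ha _) (hΔ x hx)
  have hK : 0 ≤ K := by
    refine mul_nonneg (by positivity) (setIntegral_nonneg measurableSet_ball fun x hx => ?_)
    exact mul_nonneg (sub_nonneg.2 (mem_ball_zero_iff.1 hx).le) (hΔ x hx)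
  refine ⟨∫ ζ : sphere (0 : E) 1, u ((1 / 2 : ℝ) • (ζ : E)) ∂μ.toSphere + K, ?_⟩
  rintro _ ⟨r, hr, rfl⟩
  -- Below radius `1/2` monotonicity of the spherical integrals suffices; above it the weight is at
  -- most `2^m (1 - ‖x‖)`.
  rcases le_total r (1 / 2) with h | h
  · have h1 := integral_toSphere_sub_eq_setIntegral μ hu hr.1 h (by norm_num)
    have h2 := setIntegral_nonneg (μ := μ) measurableSet_ball (hnn r (1 / 2) hr.1)
    simp only
    linarith
  · have h1 := integral_toSphere_sub_eq_setIntegral μ hu (by norm_num) h hr.2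
    have h2 : ∫ x in ball (0 : E) 1, greenWeight m (1 / 2) r ‖x‖ * (Δ u) x ∂μ ≤ K := by
      simp only [K]
      rw [← integral_const_mul]
      refine integral_mono_of_nonneg ?_ (hint.const_mul _) ?_
      · exact (ae_restrict_mem measurableSet_ball).mono (hnn _ _ (by norm_num))
      · filter_upwards [ae_restrict_mem measurableSet_ball] with x hx
        rw [← mul_assoc]
        exact mul_le_mul_of_nonneg_right
          (greenWeight_le (by norm_num) hr.2.le (mem_ball_zero_iff.1 hx).le) (hΔ x hx)
    simp only
    linarith

/-- With `R = (1 + ρ)/2`, `t ≤ ρ` gives `R - t ≥ (1 - t)/2`. For `t ≤ 1/2` the weight is its value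
at `1/2`, at least `R - 1/2 ≥ 1/4`, while `1 - t ≤ 1`; this forces the factor `4`. -/
theorem one_sub_le_four_mul_greenWeight {m : ℕ} {ρ t : ℝ} (hρ0 : 1 / 2 ≤ ρ) (hρ : ρ < 1)
    (ht0 : 0 ≤ t) (ht : t ≤ ρ) : 1 - t ≤ 4 * greenWeight m (1 / 2) ((1 + ρ) / 2) t := by
  rcases le_total t (1 / 2) with h | h
  · rw [greenWeight_of_le (by norm_num) h]
    have := sub_le_greenWeight (m := m) (a := 1 / 2) (R := (1 + ρ) / 2) (by norm_num)
      (by linarith) le_rfl (by linarith)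
    linarith
  · have := sub_le_greenWeight (m := m) (a := 1 / 2) (R := (1 + ρ) / 2) (by norm_num)
      (by linarith) h (by linarith)
    linarith

theorem integrableOn_laplacian_of_bddAbove_integral_toSphere {u : E → ℝ}
    (hu : ContDiffOn ℝ 2 u (ball 0 1)) (hΔ : ∀ x ∈ ball (0 : E) 1, 0 ≤ (Δ u) x)
    (hbdd : BddAbove ((fun r : ℝ => ∫ ζ : sphere (0 : E) 1, u (r • (ζ : E)) ∂μ.toSphere) ''
      Ioo (0 : ℝ) 1)) :
    IntegrableOn (fun x => (1 - ‖x‖) * (Δ u) x) (ball 0 1) μ := by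
  obtain ⟨B, hB⟩ := hbdd
  set m := Module.finrank ℝ E - 1
  have hcΔ : ContinuousOn (Δ u) (ball 0 1) := continuousOn_laplacian isOpen_ball hu
  have hsub : ∀ ρ < (1 : ℝ), closedBall (0 : E) ρ ⊆ ball 0 1 := fun ρ hρ => closedBall_subset_ball hρ
  have hgreen : ∀ a R : ℝ, 0 < a → R < 1 →
      Integrable (fun x : E => greenWeight m a R ‖x‖ * (Δ u) x) μ := by
    intro a R ha hR
    rw [← integrableOn_iff_integrable_of_support_subset (s := closedBall 0 R)]
    · exact (((lipschitzWith_greenWeight_norm ha).continuous.continuousOn).mul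
        (hcΔ.mono (hsub R hR))).integrableOn_compact (isCompact_closedBall _ _)
    · intro x hx
      rw [mem_closedBall_zero_iff]
      by_contra h
      exact hx (by simp [greenWeight_of_ge (not_le.1 h).le])
  -- The shift by `2` makes `ρ 0 = 1/2`. The closed balls of radius `ρ k` exhaust the unit ball, and
  -- a uniform bound on their integrals gives integrability.
  set ρ : ℕ → ℝ := fun k => 1 - 1 / ((k : ℝ) + 2)
  have hρ1 : ∀ k, ρ k < 1 := fun k => by
    have : (0 : ℝ) < 1 / ((k : ℝ) + 2) := by positivity
    simp only [ρ]; linarith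
  have hρ0 : ∀ k, 1 / 2 ≤ ρ k := fun k => by
    have : 1 / ((k : ℝ) + 2) ≤ 1 / 2 :=
      one_div_le_one_div_of_le two_pos (by linarith [k.cast_nonneg (α := ℝ)])
    simp only [ρ]; linarith
  have hρlim : Filter.Tendsto ρ Filter.atTop (nhds 1) := by
    have h := (tendsto_const_div_atTop_nhds_zero_nat (1 : ℝ)).comp (Filter.tendsto_add_atTop_nat 2)
    have h' := h.const_sub 1
    simpa [ρ, Function.comp_def] using h'
  have hcover : AECover (μ.restrict (ball 0 1)) Filter.atTop fun k => closedBall (0 : E) (ρ k) := by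
    refine ⟨?_, fun k => measurableSet_closedBall⟩
    filter_upwards [ae_restrict_mem measurableSet_ball] with x hx
    filter_upwards [hρlim.eventually (lt_mem_nhds (mem_ball_zero_iff.1 hx))] with k hk
    exact mem_closedBall_zero_iff.2 hk.le
  have hrestr : ∀ k, (μ.restrict (ball 0 1)).restrict (closedBall (0 : E) (ρ k)) =
      μ.restrict (closedBall 0 (ρ k)) := fun k => by
    rw [Measure.restrict_restrict measurableSet_closedBall,
      inter_eq_self_of_subset_left (hsub _ (hρ1 k))]
  have hcomp : ∀ k, IntegrableOn (fun x => (1 - ‖x‖) * (Δ u) x) (closedBall (0 : E) (ρ k)) μ :=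
    fun k => ContinuousOn.integrableOn_compact (isCompact_closedBall _ _)
      (ContinuousOn.mul (by fun_prop) (hcΔ.mono (hsub _ (hρ1 k))))
  refine hcover.integrable_of_integral_bounded_of_nonneg_ae
    (4 * (B - ∫ ζ : sphere (0 : E) 1, u ((1 / 2 : ℝ) • (ζ : E)) ∂μ.toSphere)) (fun k => ?_) ?_
    (.of_forall fun k => ?_)
  · rw [IntegrableOn, hrestr]
    exact hcomp k
  · filter_upwards [ae_restrict_mem measurableSet_ball] with x hx
    exact mul_nonneg (sub_nonneg.2 (mem_ball_zero_iff.1 hx).le) (hΔ x hx)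
  · set R := (1 + ρ k) / 2
    have hR1 : R < 1 := by have := hρ1 k; simp only [R]; linarith
    have hR0 : 1 / 2 ≤ R := by have := hρ0 k; simp only [R]; linarith
    have hid := integral_toSphere_sub_eq_setIntegral μ hu (a := 1 / 2) (by norm_num) hR0 hR1
    have hBR := hB (mem_image_of_mem _ (⟨by linarith, hR1⟩ : R ∈ Ioo (0 : ℝ) 1))
    have hg := hgreen (1 / 2) R (by norm_num) hR1
    rw [hrestr]
    calc
      ∫ x in closedBall (0 : E) (ρ k), (1 - ‖x‖) * (Δ u) x ∂μ ≤
          ∫ x in closedBall (0 : E) (ρ k), 4 * (greenWeight m (1 / 2) R ‖x‖ * (Δ u) x) ∂μ := by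
        refine setIntegral_mono_on (hcomp k) (hg.const_mul 4).integrableOn
          measurableSet_closedBall fun x hx => ?_
        rw [← mul_assoc]
        exact mul_le_mul_of_nonneg_right (one_sub_le_four_mul_greenWeight (hρ0 k) (hρ1 k)
          (norm_nonneg x) (mem_closedBall_zero_iff.1 hx)) (hΔ x (hsub _ (hρ1 k) hx))
      _ ≤ ∫ x in ball (0 : E) 1, 4 * (greenWeight m (1 / 2) R ‖x‖ * (Δ u) x) ∂μ := by
        refine setIntegral_mono_set (hg.const_mul 4).integrableOn ?_ (hsub _ (hρ1 k)).eventuallyLE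
        filter_upwards [ae_restrict_mem measurableSet_ball] with x hx
        exact mul_nonneg zero_le_four
          (mul_nonneg (greenWeight_nonneg (by norm_num) _) (hΔ x hx))
      _ ≤ _ := by
        rw [integral_const_mul]
        linarith

end Subharmonic

/-! ### Boundary distance, normalizations and the conclusion. -/

theorem boundaryDist_eq_one_sub_norm {n : ℕ} [Nontrivial (CSpace n)] {z : CSpace n}
    (hz : z ∈ unitBall n) : boundaryDist z = 1 - ‖z‖ := by
  have hz1 : ‖z‖ < 1 := mem_ball_zero_iff.1 hz
  rw [boundaryDist, unitBall, frontier_ball 0 one_ne_zero]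
  refine le_antisymm ?_ ?_
  · obtain ⟨ζ, hζ, hzζ⟩ : ∃ ζ : CSpace n, ‖ζ‖ = 1 ∧ z = ‖z‖ • ζ := by
      by_cases h : z = 0
      · obtain ⟨ζ, hζ⟩ := exists_norm_eq (CSpace n) zero_le_one
        exact ⟨ζ, hζ, by simp [h]⟩
      · refine ⟨‖z‖⁻¹ • z, by simp [norm_smul, h], ?_⟩
        rw [smul_inv_smul₀ (norm_ne_zero_iff.2 h)]
    refine (infDist_le_dist_of_mem (mem_sphere_zero_iff_norm.2 hζ)).trans_eq ?_
    have : z - ζ = (‖z‖ - 1) • ζ := by rw [sub_smul, one_smul, ← hzζ]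
    rw [dist_eq_norm, this, norm_smul, hζ, mul_one, Real.norm_eq_abs, abs_of_neg (by linarith)]
    ring
  · refine (le_infDist (NormedSpace.sphere_nonempty.2 zero_le_one)).2 fun y hy => ?_
    have h1 : ‖y‖ = 1 := mem_sphere_zero_iff_norm.1 hy
    have h2 := norm_sub_norm_le y z
    rw [dist_comm, dist_eq_norm]
    linarith

theorem integrable_normalizedVolume_iff {n : ℕ} (g : CSpace n → ℝ) :
    Integrable g (normalizedVolume n) ↔ IntegrableOn g (ball 0 1) := by
  refine integrable_smul_measure (ENNReal.inv_ne_zero.2 measure_ball_lt_top.ne)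
    (ENNReal.inv_ne_top.2 ?_)
  exact (measure_ball_pos _ _ one_pos).ne'

theorem inv_toSphere_univ_ne_zero (n : ℕ) :
    ((volume : Measure (CSpace n)).toSphere univ)⁻¹ ≠ 0 :=
  ENNReal.inv_ne_zero.2 (measure_ne_top _ _)

theorem inv_toSphere_univ_ne_top (n : ℕ) [Nontrivial (CSpace n)] :
    ((volume : Measure (CSpace n)).toSphere univ)⁻¹ ≠ ⊤ :=
  ENNReal.inv_ne_top.2 (Measure.measure_univ_ne_zero.2 (Measure.toSphere_ne_zero _))

theorem integralMean_eq {n : ℕ} (p r : ℝ) (f : CSpace n → ℂ) :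
    integralMean p r f = (((volume : Measure (CSpace n)).toSphere univ)⁻¹.toReal *
      ∫ ζ : sphere (0 : CSpace n) 1, ‖f (r • (ζ : CSpace n))‖ ^ p
        ∂(volume : Measure (CSpace n)).toSphere) ^ (1 / p) := by
  rw [integralMean, normalizedSurface, integral_smul_measure, smul_eq_mul]

theorem bddAbove_image_mul_rpow_iff {s : Set ℝ} {M : ℝ → ℝ} (hM : ∀ r ∈ s, 0 ≤ M r) {c q : ℝ}
    (hc : 0 < c) (hq : 0 < q) :
    BddAbove ((fun r => (c * M r) ^ q) '' s) ↔ BddAbove (M '' s) := by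
  constructor
  · rintro ⟨B, hB⟩
    refine ⟨c⁻¹ * B ^ q⁻¹, ?_⟩
    rintro _ ⟨r, hr, rfl⟩
    have h0 : 0 ≤ c * M r := mul_nonneg hc.le (hM r hr)
    have h1 := Real.rpow_le_rpow (by positivity) (hB (mem_image_of_mem _ hr)) (inv_nonneg.2 hq.le)
    simp only [Real.rpow_rpow_inv h0 hq.ne'] at h1
    rwa [← div_eq_inv_mul, le_div_iff₀' hc]
  · rintro ⟨B, hB⟩
    refine ⟨(c * B) ^ q, ?_⟩
    rintro _ ⟨r, hr, rfl⟩
    have h1 := hB (mem_image_of_mem _ hr)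
    exact Real.rpow_le_rpow (mul_nonneg hc.le (hM r hr)) (by gcongr) hq.le

/-- Continuity of `f` supplies measurability and, by compactness of the sphere, existence of the
means; only the supremum condition has content. -/
theorem memGeneralizedHardy_iff_bddAbove {n : ℕ} [Nontrivial (CSpace n)] {p : ℝ} (hp : 0 < p)
    {f : CSpace n → ℂ} (hf : ContinuousOn f (unitBall n)) :
    MemGeneralizedHardy p f ↔ BddAbove ((fun r : ℝ => ∫ ζ : sphere (0 : CSpace n) 1,
      ‖f (r • (ζ : CSpace n))‖ ^ p ∂(volume : Measure (CSpace n)).toSphere) '' Ioo (0 : ℝ) 1) := by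
  have hcont : ContinuousOn (fun z : CSpace n => ‖f z‖ ^ p) (ball 0 1) :=
    hf.norm.rpow_const fun _ _ => .inr hp.le
  have hiff := bddAbove_image_mul_rpow_iff (s := Ioo (0 : ℝ) 1)
    (M := fun r : ℝ => ∫ ζ : sphere (0 : CSpace n) 1,
      ‖f (r • (ζ : CSpace n))‖ ^ p ∂(volume : Measure (CSpace n)).toSphere)
    (fun r _ => integral_nonneg fun ζ => by positivity)
    (ENNReal.toReal_pos (inv_toSphere_univ_ne_zero n) (inv_toSphere_univ_ne_top n))
    (one_div_pos.2 hp)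
  simp only [← integralMean_eq] at hiff
  rw [← hiff]
  refine ⟨fun h => h.bddAbove, fun h => ⟨hf.aemeasurable measurableSet_ball, fun r hr => ?_, h⟩⟩
  exact (integrable_comp_smul_toSphere volume hcont hr).smul_measure (inv_toSphere_univ_ne_top n)

theorem mainTheorem8 (n : ℕ) (hn : 1 ≤ n) (p : ℝ) (hp : 2 ≤ p)
    (τ η : CSpace n → ℝ)
    (hτ : ContinuousOn τ (unitBall n)) (hη : ContinuousOn η (unitBall n))
    (hτ0 : ∀ z ∈ unitBall n, 0 ≤ τ z) (hη0 : ∀ z ∈ unitBall n, 0 ≤ η z)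
    (f : CSpace n → ℂ) (hf : ContDiffOn ℝ 2 f (unitBall n)) (hfeq : SolvesYukawa τ η f) :
    Integrable (fun z : CSpace n => boundaryDist z * (Δ (fun w : CSpace n => ‖f w‖ ^ p)) z)
        (normalizedVolume n) ↔
      MemGeneralizedHardy p f := by
  have : Nonempty (Fin n) := ⟨⟨0, hn⟩⟩
  have : Nontrivial (CSpace n) := inferInstance
  have hu : ContDiffOn ℝ 2 (fun w : CSpace n => ‖f w‖ ^ p) (ball 0 1) :=
    (contDiff_two_norm_rpow hp).comp_contDiffOn hf
  have hΔ : ∀ z ∈ ball (0 : CSpace n) 1, 0 ≤ (Δ fun w : CSpace n => ‖f w‖ ^ p) z := fun z hz =>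
    laplacian_norm_rpow_nonneg_of_solvesYukawa hp hf hfeq hz (hτ0 z hz) (hη0 z hz)
  rw [integrable_normalizedVolume_iff, memGeneralizedHardy_iff_bddAbove (by linarith)
    hf.continuousOn, integrableOn_congr_fun (fun z hz => by
      rw [boundaryDist_eq_one_sub_norm hz]) measurableSet_ball]
  exact ⟨bddAbove_integral_toSphere_of_integrableOn_laplacian volume hu hΔ,
    integrableOn_laplacian_of_bddAbove_integral_toSphere volume hu hΔ⟩
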